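/- Setting. Let $M$ be $\mathbb R^2$ or a closed surface of genus $g\ge 1$, with a symplectic form $\omega$. Let $\varphi$ be a symplectomorphism of $(M,\omega)$ with a hyperbolic fixed point $x$, and let $W^s=\{p:\varphi^n(p)\to x,\ n\to\infty\}$ and $W^u=\{p:\varphi^{n}(p)\to x,\ n\to-\infty\}$ be its stable and unstable manifolds (injectively immersed lines). Assume that $\varphi$ preserves the orientations of $W^s$ and $W^u$, that all intersections of $W^s$ and $W^u$ are transverse, and that each branch of $W^u$ (component of $W^u\setminus\{x\}$ as a line) meets each branch of $W^s$. Fix an orientation $o_u$ of $W^u$. Let $\mathcal H_{[x]}$ be the set of contractible homoclinic points: those $p\in W^s\cap W^u$ for which the loop running from $x$ to $p$ in $W^u$ and back from $p$ to $x$ in $W^s$ is trivial in $\pi_1(M,x)$. For homoclinic points $p,q$ such that the loop running from $p$ to $q$ in $W^u$ and back from $q$ to $p$ in $W^s$ is contractible, $\mu(p,q)\in\mathbb Z$ denotes the relative Maslov index: twice the winding number of the tangent direction of this loop, where the intersections at $p$ and $q$ are first made perpendicular and the direction is turned by $+90^\circ$ at $q$ and by $-90^\circ$ at $p$. Put $\mu(p)=\mu(p,x)$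 for $p\in\mathcal H_{[x]}$. For $p,q\in\mathcal H_{[x]}$ with $\mu(q)=\mu(p)-1$ let $n(p,q)\in\{-1,0,1\}$ be $0$ if there is no smooth orientation preserving immersion (also at boundary and vertices) into $M$ of the di-gon with convex vertices $(-1,0)$, $(1,0)$ that maps the lower boundary arc into $W^u$, the upper boundary arc into $W^s$, $(-1,0)$ to $p$ and $(1,0)$ to $q$. If there is one, let $n(p,q)=1$ if the direction from $p$ to $q$ in $W^u$ agrees with $o_u$, and $n(p,q)=-1$ otherwise. For a finite set $E\subseteq\mathcal H_{[x]}$ let $\mathbb ZE$ be the free abelian group on $E$, graded by $\mu$, with graded parts $\mathbb ZE_k$, $k\in\mathbb Z$, and let $\partial^E:\mathbb ZE\to\mathbb ZE$ be the linear map with $$\partial^E p=\sum_{q\in E,\ \mu(q)=\mu(p)-1} n(p,q)\,q\qquad(p\in E).$$ $E$ is called $\partial$-complete if $\partial^E\circ\partial^E=0$. For $D'\subseteq E'$ finite, the restriction $\mathcal R^{E'D'}:\mathbb ZE'\to\mathbb ZD'$ is the linear map with $p\mapsto p$ for $p\in D'$ and $p\mapsto 0$ for $p\in E'\setminus D'$.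 The $D'$-component of $\partial^{E'}$ is the linear map $\partial^{E'_{D'}}:\mathbb ZE'\to\mathbb ZE'$ with $$\partial^{E'_{D'}}p=\sum_{q\in D',\ \mu(q)=\mu(p)-1} n(p,q)\,q\qquad(p\in E').$$ Lemma. Let $D'\subseteq E'$ be finite $\partial$-complete subsets of $\mathcal H_{[x]}$. Then $\mathcal R^{E'D'}:(\mathbb ZE',\partial^{E'})\to(\mathbb ZD',\partial^{D'})$ is a chain map, i.e. it preserves degrees and $\mathcal R^{E'D'}_{k-1}\circ\partial^{E'}_k=\partial^{D'}_k\circ\mathcal R^{E'D'}_k$ for all $k\in\mathbb Z$, if and only if $\partial^{E'_{D'}}(p)=0$ for every $p\in E'\setminus D'$. -/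

import Mathlib

open scoped Manifold ContDiff Topology

noncomputable section

namespace HomoclinicFloer

/-! ### Surfaces with an area form -/

section Surface

/-- The plane `ℝ²` with its Euclidean structure. -/
abbrev Plane : Type := EuclideanSpace ℝ (Fin 2)

variable {M : Type*} [TopologicalSpace M] [ChartedSpace Plane M]

/-- `M` is `ℝ²` (up to diffeomorphism) or a closed surface of genus at least one.  A compact
connected surface without boundary carrying an area form is orientable, and then its genus is
at least one exactly if it is not simply connected. -/
def IsPlaneOrPositiveGenus (M : Type*) [TopologicalSpace M] [ChartedSpace Plane M] : Prop :=
  Nonempty (M ≃ₘ⟮𝓡 2, 𝓡 2⟯ Plane) ∨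
    (CompactSpace M ∧ ConnectedSpace M ∧ ¬ SimplyConnectedSpace M)

/-- A (not necessarily smooth) field of alternating bilinear forms on the tangent spaces. -/
abbrev TwoForm (M : Type*) [TopologicalSpace M] [ChartedSpace Plane M] : Type _ :=
  ∀ p : M, TangentSpace (𝓡 2) p [⋀^Fin 2]→L[ℝ] ℝ

/-- The `i`-th coordinate vector field of the chart around `c`. -/
def coordField (c : M) (i : Fin 2) (p : M) : TangentSpace (𝓡 2) p :=
  mfderiv (𝓡 2) (𝓡 2) (chartAt Plane c).symm (chartAt Plane c p)
    (EuclideanSpace.single i (1 : ℝ) : Plane)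

/-- A symplectic form on a surface: a smooth, nowhere vanishing 2-form.  (In dimension two,
closedness is automatic and nondegeneracy means nowhere vanishing.) -/
structure IsSymplecticForm (Ω : TwoForm M) : Prop where
  smooth : ∀ c : M, ContMDiffOn (𝓡 2) 𝓘(ℝ, ℝ) ∞
    (fun p => Ω p ![coordField c 0 p, coordField c 1 p]) (chartAt Plane c).source
  ne_zero : ∀ p, Ω p ≠ 0

/-- `φ` preserves `Ω`. -/
def IsSymplectomorphism (Ω : TwoForm M) (φ : M ≃ₘ⟮𝓡 2, 𝓡 2⟯ M) : Prop :=
  ∀ (p : M) (v w : TangentSpace (𝓡 2) p),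
    Ω (φ p) ![mfderiv (𝓡 2) (𝓡 2) φ p v, mfderiv (𝓡 2) (𝓡 2) φ p w] = Ω p ![v, w]

/-- The differential of `f` at `x`, read as an endomorphism of the model space of `T_x M`
(this is the endomorphism `Df(x)` of `T_x M` if `f x = x`). -/
def endoAt (f : M → M) (x : M) : Plane →L[ℝ] Plane := mfderiv (𝓡 2) (𝓡 2) f x

/-- `x` is a hyperbolic fixed point of `f`: it is fixed, and no complex eigenvalue of `Df(x)`
has modulus one. -/
def IsHyperbolicFixedPoint (f : M → M) (x : M) : Prop :=
  f x = x ∧ ∀ z : ℂ,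
    Polynomial.aeval z (LinearMap.charpoly (endoAt f x : Plane →ₗ[ℝ] Plane)) = 0 → ‖z‖ ≠ 1

/-! ### Stable and unstable manifolds -/

/-- The stable manifold of `x` as a set.  The unstable one is the stable one of the inverse. -/
def stableSet (f : M → M) (x : M) : Set M :=
  {p | Filter.Tendsto (fun n : ℕ => f^[n] p) Filter.atTop (𝓝 x)}

/-- The velocity vector `γ'(t)` of a curve, as a point of the tangent bundle. -/
def velocity (γ : ℝ → M) (t : ℝ) : TangentBundle (𝓡 2) M :=
  ⟨γ t, mfderiv 𝓘(ℝ, ℝ) (𝓡 2) γ t (1 : ℝ)⟩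

/-- `γ` parametrizes the stable manifold of the hyperbolic fixed point `x` of `f` as an
injectively immersed line, with `γ 0 = x`.  The parameter is the one in which `f` acts linearly;
it is unique up to a nonzero factor, so that the immersed line is determined by `f` and `x`. -/
structure IsStableParam (f : M → M) (x : M) (γ : ℝ → M) : Prop where
  smooth : ContMDiff 𝓘(ℝ, ℝ) (𝓡 2) ∞ γ
  injective : Function.Injective γ
  immersion : ∀ t, (velocity γ t).2 ≠ 0
  zero : γ 0 = x
  range_eq : Set.range γ = stableSet f x
  linear : ∃ c : ℝ, |c| < 1 ∧ ∀ t, f (γ t) = γ (c * t)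

variable (φ : M ≃ₘ⟮𝓡 2, 𝓡 2⟯ M) (x : M)

/-- The stable manifold `W^s`. -/
def Ws : Set M := stableSet φ x

/-- The unstable manifold `W^u`. -/
def Wu : Set M := stableSet φ.symm x

/-- Parametrizations of the immersed line `W^s`. -/
def IsWsParam (γ : ℝ → M) : Prop := IsStableParam φ x γ

/-- Parametrizations of the immersed line `W^u`. -/
def IsWuParam (γ : ℝ → M) : Prop := IsStableParam φ.symm x γ

/-- All intersections of `W^s` and `W^u` are transverse: their tangent lines differ. -/
def TransverselyIntersecting : Prop :=
  ∀ γs γu : ℝ → M, IsWsParam φ x γs → IsWuParam φ x γu → ∀ a b : ℝ, γs a = γu b →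
    ¬ ∃ c : ℝ, velocity γs a = ⟨γu b, c • (velocity γu b).2⟩

/-- Each branch of `W^u` intersects each branch of `W^s`.  The branches are the images of the
positive half-line under the parametrizations `t ↦ γ t` and `t ↦ γ (-t)`. -/
def StronglyIntersecting : Prop :=
  ∀ γs γu : ℝ → M, IsWsParam φ x γs → IsWuParam φ x γu →
    (γs '' Set.Ioi 0 ∩ γu '' Set.Ioi 0).Nonempty

/-- `φ` preserves the orientations of `W^s` and of `W^u`. -/
def WOrientationPreserving : Prop :=
  ∀ γ : ℝ → M, (IsWsParam φ x γ ∨ IsWuParam φ x γ) → ∀ t t' : ℝ, φ (γ t) = γ t' →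
    ∃ c : ℝ, 0 < c ∧
      (⟨φ (γ t), mfderiv (𝓡 2) (𝓡 2) φ (γ t) (velocity γ t).2⟩ : TangentBundle (𝓡 2) M) =
        ⟨γ t', c • (velocity γ t').2⟩

/-- An orientation of the line `W^u`, given by a nonzero vector `o` tangent to `W^u` at `x`,
that is, by an eigenvector of `Dφ(x)` for the expanding eigenvalue. -/
def IsWuOrientation (o : Plane) : Prop :=
  o ≠ 0 ∧ ∃ c : ℝ, 1 < |c| ∧ endoAt φ x o = c • o

/-! ### Contractible homoclinic points -/

/-- The homoclinic points (including `x` itself). -/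
def homoclinic : Set M := Ws φ x ∩ Wu φ x

/-- The contractible homoclinic points `p`: the loop that runs from `x` to `p` inside `W^u` and
from `p` back to `x` inside `W^s` is trivial in `π₁(M, x)`. -/
def contractible : Set M :=
  {p | p ∈ homoclinic φ x ∧ ∃ (γs γu : ℝ → M) (a b : ℝ) (cu : Path x p) (cs : Path p x),
    IsWsParam φ x γs ∧ IsWuParam φ x γu ∧
    (∀ t, cu t = γu (t * a)) ∧ (∀ t, cs t = γs ((1 - t) * b)) ∧
    (cu.trans cs).Homotopic (Path.refl x)}

/-! ### Maslov index -/

variable [IsManifold (𝓡 2) ∞ M] (Ω : TwoForm M)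

/-- A strip `u` from `p` to `q`, whose lower edge runs through the segment of `W^u` from `p`
to `q`, whose upper edge runs through the segment of `W^s` from `p` to `q` and whose left and right
edges are constant, with a positively oriented frame `e₁, e₂` of the pulled back tangent bundle
that is constant on the left and right edges, and continuous angles `α`, `β` of the tangent lines
of `W^u` and `W^s` along the lower and upper edge in this frame. -/
structure FramedStrip (p q : M) where
  γu : ℝ → M
  γs : ℝ → M
  isWuParam : IsWuParam φ x γu
  isWsParam : IsWsParam φ x γs
  a₀ : ℝ
  a₁ : ℝ
  b₀ : ℝ
  b₁ : ℝ
  γu_a₀ : γu a₀ = p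
  γu_a₁ : γu a₁ = q
  γs_b₀ : γs b₀ = p
  γs_b₁ : γs b₁ = q
  u : unitInterval × unitInterval → M
  e₁ : ∀ z, TangentSpace (𝓡 2) (u z)
  e₂ : ∀ z, TangentSpace (𝓡 2) (u z)
  continuous_u : Continuous u
  continuous_e₁ : Continuous fun z => (⟨u z, e₁ z⟩ : TangentBundle (𝓡 2) M)
  continuous_e₂ : Continuous fun z => (⟨u z, e₂ z⟩ : TangentBundle (𝓡 2) M)
  oriented : ∀ z, 0 < Ω (u z) ![e₁ z, e₂ z]
  left_e₁ : ∀ s, (⟨u (0, s), e₁ (0, s)⟩ : TangentBundle (𝓡 2) M) = ⟨u (0, 0), e₁ (0, 0)⟩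
  left_e₂ : ∀ s, (⟨u (0, s), e₂ (0, s)⟩ : TangentBundle (𝓡 2) M) = ⟨u (0, 0), e₂ (0, 0)⟩
  right_e₁ : ∀ s, (⟨u (1, s), e₁ (1, s)⟩ : TangentBundle (𝓡 2) M) = ⟨u (1, 0), e₁ (1, 0)⟩
  right_e₂ : ∀ s, (⟨u (1, s), e₂ (1, s)⟩ : TangentBundle (𝓡 2) M) = ⟨u (1, 0), e₂ (1, 0)⟩
  α : unitInterval → ℝ
  β : unitInterval → ℝ
  continuous_α : Continuous α
  continuous_β : Continuous β
  lower : ∀ t : unitInterval, ∃ c : ℝ, c ≠ 0 ∧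
    velocity γu (a₀ + t * (a₁ - a₀)) =
      ⟨u (t, 0), c • (Real.cos (α t) • e₁ (t, 0) + Real.sin (α t) • e₂ (t, 0))⟩
  upper : ∀ t : unitInterval, ∃ c : ℝ, c ≠ 0 ∧
    velocity γs (b₀ + t * (b₁ - b₀)) =
      ⟨u (t, 1), c • (Real.cos (β t) • e₁ (t, 1) + Real.sin (β t) • e₂ (t, 1))⟩

/-- The number of signed half-turns that the tangent line of `W^u` makes relative to the tangent
line of `W^s` on the way from `p` to `q`.  If `W^s` and `W^u` are perpendicular at `p` and `q`,
this is `((α 1 - β 1) - (α 0 - β 0)) / π`, twice the winding number of the tangent of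
the loop from `p` through `W^u` to `q` and through `W^s` back to `p`, turning by `+90°` at `q` and
by `-90°` at `p`; the integer parts account for deforming the intersections at `p` and `q`
transversely to perpendicular ones. -/
def FramedStrip.index {φ : M ≃ₘ⟮𝓡 2, 𝓡 2⟯ M} {x : M} {Ω : TwoForm M} {p q : M}
    (S : FramedStrip φ x Ω p q) : ℤ :=
  ⌊(S.α 1 - S.β 1) / Real.pi⌋ - ⌊(S.α 0 - S.β 0) / Real.pi⌋

open Classical in
/-- The relative Maslov index `μ(p, q)` of homoclinic points of the same homotopy class.  On the
surfaces considered here it does not depend on the strip because `π₂(M) = 0`. -/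
def maslovIndex (p q : M) : ℤ :=
  if h : Nonempty (FramedStrip φ x Ω p q) then h.some.index else 0

/-- The Maslov grading `μ(p) = μ(p, x)` of contractible homoclinic points. -/
def maslov (p : contractible φ x) : ℤ := maslovIndex φ x Ω p x

/-! ### Immersed di-gons and signs -/

/-- The di-gon, with convex vertices `(-1, 0)` and `(1, 0)`. -/
def digon : Set Plane := {z | |z 1| ≤ 1 - z 0 ^ 2}

/-- The lower boundary `B_u` of the di-gon. -/
def digonLower : Set Plane := {z | |z 0| ≤ 1 ∧ z 1 = -(1 - z 0 ^ 2)}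

/-- The upper boundary `B_s` of the di-gon. -/
def digonUpper : Set Plane := {z | |z 0| ≤ 1 ∧ z 1 = 1 - z 0 ^ 2}

/-- `v` is a smooth, orientation preserving immersion of the (closed) di-gon, also at the boundary
and at the vertices, that maps the lower boundary to `W^u`, the upper boundary to `W^s`, and the
vertices `(-1, 0)` and `(1, 0)` to `p` and `q`. -/
structure IsImmersedDigon (p q : M) (v : Plane → M) : Prop where
  smooth : ContMDiffOn (𝓡 2) (𝓡 2) ∞ v digon
  oriented : ∀ z ∈ digon,
    0 < Ω (v z) ![mfderivWithin (𝓡 2) (𝓡 2) v digon z (EuclideanSpace.single 0 (1 : ℝ) : Plane),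
      mfderivWithin (𝓡 2) (𝓡 2) v digon z (EuclideanSpace.single 1 (1 : ℝ) : Plane)]
  lower : ∀ z ∈ digonLower, v z ∈ Wu φ x
  upper : ∀ z ∈ digonUpper, v z ∈ Ws φ x
  left : v !₂[-1, 0] = p
  right : v !₂[1, 0] = q

/-- The direction from `p` to `q` in `W^u` agrees with the orientation of `W^u` given by `o`. -/
def AgreesWithOrientation (o : Plane) (p q : M) : Prop :=
  ∃ (γu : ℝ → M) (a b : ℝ), IsWuParam φ x γu ∧
    (∃ c : ℝ, 0 < c ∧ velocity γu 0 = ⟨x, (c • o : Plane)⟩) ∧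
    γu a = p ∧ γu b = q ∧ a < b

open Classical in
/-- The signs `n(p, q)`.  (The space of immersed di-gons modulo reparametrization is nonempty if
and only if there is an immersed di-gon.) -/
def sign (o : Plane) (p q : contractible φ x) : ℤ :=
  if ∃ v, IsImmersedDigon φ x Ω (p : M) (q : M) v then
    if AgreesWithOrientation φ x o (p : M) (q : M) then 1 else -1
  else 0

end Surface

/-! ### The modules `ℤE` and their boundary operators

In this section `X` is the set of generators, `μ` their grading and `n` their signs. -/

section Algebra

variable {X : Type*} (μ : X → ℤ) (n : X → X → ℤ)

/-- The free abelian group `ℤE` generated by the elements of `E`. -/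
abbrev Chains (E : Finset X) : Type _ := E →₀ ℤ

/-- The graded part `ℤE_k`, generated by the elements of `E` of degree `k`. -/
def degreePart (E : Finset X) (k : ℤ) : Submodule ℤ (Chains E) :=
  Submodule.span ℤ {c | ∃ p : E, μ p = k ∧ c = Finsupp.single p 1}

open Classical in
/-- For `A ⊆ E`, the linear map `ℤE → ℤE` with `p ↦ ∑ n(p, q) q`, where the sum is over all
`q ∈ A` of degree `μ(p) - 1`.  This is the `A`-component of the boundary operator of `E`. -/
def boundaryComponent (E A : Finset X) : Chains E →ₗ[ℤ] Chains E :=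
  Finsupp.linearCombination ℤ fun p : E =>
    ∑ q ∈ Finset.univ.filter (fun q : E => (q : X) ∈ A ∧ μ q = μ p - 1), n p q • Finsupp.single q (1 : ℤ)

open Classical in
/-- The boundary operator `∂^E p = ∑ n(p, q) q`, summed over all `q ∈ E` of degree `μ(p) - 1`. -/
def boundary (E : Finset X) : Chains E →ₗ[ℤ] Chains E :=
  Finsupp.linearCombination ℤ fun p : E =>
    ∑ q ∈ Finset.univ.filter (fun q : E => μ q = μ p - 1), n p q • Finsupp.single q (1 : ℤ)

/-- `E` is `∂`-complete. -/
def IsComplete (E : Finset X) : Prop := boundary μ n E ∘ₗ boundary μ n E = 0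

open Classical in
/-- The restriction `ℤE → ℤD`: the identity on generators in `D`, zero on the others. -/
def restriction (E D : Finset X) : Chains E →ₗ[ℤ] Chains D :=
  Finsupp.linearCombination ℤ fun p : E =>
    if h : (p : X) ∈ D then Finsupp.single (⟨p, h⟩ : D) (1 : ℤ) else 0

/-- A linear map `f : ℤE → ℤD` is a chain map if, in each degree `k`, it maps `ℤE_k` to `ℤD_k`
and its components satisfy `f_{k-1} ∘ ∂^E_k = ∂^D_k ∘ f_k`. -/
def IsChainMap {E D : Finset X} (f : Chains E →ₗ[ℤ] Chains D) : Prop :=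
  ∀ k : ℤ, ∀ c ∈ degreePart μ E k,
    f c ∈ degreePart μ D k ∧ f (boundary μ n E c) = boundary μ n D (f c)

end Algebra

end HomoclinicFloer

end

open scoped Manifold ContDiff

namespace HomoclinicFloer

section Algebra

variable {X : Type*} (μ : X → ℤ) (n : X → X → ℤ)

/-! The statement is linear algebra, checked on generators. Restriction sends a generator to itself
or to zero, so it always preserves degrees, and only the commutation with the boundary operators is
at stake. The coefficient n(p, q) and the condition on degrees do not depend on the ambient finite
set. Hence for p in D both composites give the sum of n(p, q) q over the q in D of degree one less,
and they agree unconditionally. For p outside D the composite through ℤD vanishes, while the other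
one is the part of the boundary of p lying over D. This has the same coefficients as the
D-component, so commutation at p says exactly that the D-component of p is zero. -/

theorem boundary_single_apply (E : Finset X) (p q : E) :
    boundary μ n E (Finsupp.single p 1) q = if μ q = μ p - 1 then n p q else 0 := by
  classical
  simp only [boundary, Finsupp.linearCombination_single, one_smul, Finset.sum_filter]
  -- Distinct generators are independent, so only the summand at `q` contributes to the coefficient
  -- at `q`.
  rw [Finsupp.finsetSum_apply, Finset.sum_eq_single q]
  · split_ifs <;> simp
  · intro r _ hr
    split_ifs <;> simp [hr]
  · simp

open Classical in
theorem boundaryComponent_single_apply (E A : Finset X) (p q : E) :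
    boundaryComponent μ n E A (Finsupp.single p 1) q =
      if (q : X) ∈ A ∧ μ q = μ p - 1 then n p q else 0 := by
  simp only [boundaryComponent, Finsupp.linearCombination_single, one_smul, Finset.sum_filter]
  rw [Finsupp.finsetSum_apply, Finset.sum_eq_single q]
  · split_ifs <;> simp
  · intro r _ hr
    split_ifs <;> simp [hr]
  · simp

theorem restriction_single_of_mem (E D : Finset X) (p : E) (hp : (p : X) ∈ D) :
    restriction E D (Finsupp.single p 1) = Finsupp.single ⟨p, hp⟩ 1 := by
  classical
  simp [restriction, hp]

theorem restriction_single_of_notMem (E D : Finset X) (p : E) (hp : (p : X) ∉ D) :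
    restriction E D (Finsupp.single p 1) = 0 := by
  classical
  simp [restriction, hp]

/-- For `D ⊆ E`, restriction to `D` leaves the coefficients at points of `D` unchanged. -/
theorem restriction_apply {E D : Finset X} (hDE : D ⊆ E) (c : Chains E) (q : D) :
    restriction E D c q = c ⟨q, hDE q.2⟩ := by
  classical
  induction c using Finsupp.induction_linear with
  | zero => simp
  | add c d hc hd => simp [hc, hd]
  | single p a =>
    -- Pulling out the scalar `a` reduces the claim to the generator with coefficient 1.
    rw [← mul_one a, ← smul_eq_mul, ← Finsupp.smul_single, map_smul, Finsupp.smul_apply,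
      Finsupp.smul_apply]
    congr 1
    by_cases hp : (p : X) ∈ D
    · rw [restriction_single_of_mem E D p hp]
      -- Generators of `D` and of `E` have different types; equality in either is equality of the
      -- underlying points of `X`.
      simp only [Finsupp.single_apply, Subtype.ext_iff]
    · rw [restriction_single_of_notMem E D p hp, Finsupp.single_eq_of_ne]
      · rfl
      · rintro rfl
        exact hp q.2

theorem single_mem_degreePart (E : Finset X) (p : E) :
    Finsupp.single p 1 ∈ degreePart μ E (μ p) :=
  Submodule.subset_span ⟨p, rfl, rfl⟩

theorem restriction_mem_degreePart (E D : Finset X) {k : ℤ} {c : Chains E}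
    (hc : c ∈ degreePart μ E k) : restriction E D c ∈ degreePart μ D k := by
  induction hc using Submodule.span_induction with
  | mem c hc =>
    obtain ⟨p, rfl, rfl⟩ := hc
    by_cases hp : (p : X) ∈ D
    · rw [restriction_single_of_mem E D p hp]
      exact single_mem_degreePart μ D ⟨p, hp⟩
    · rw [restriction_single_of_notMem E D p hp]
      exact zero_mem _
  | zero => simp
  | add c d _ _ hc hd => simpa using add_mem hc hd
  | smul a c _ hc => simpa using Submodule.smul_mem _ a hc

/-- Restriction is a chain map iff it commutes with the boundary operators on generators. -/
theorem isChainMap_restriction_iff (E D : Finset X) :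
    IsChainMap μ n (restriction E D) ↔
      ∀ p : E, restriction E D (boundary μ n E (Finsupp.single p 1)) =
        boundary μ n D (restriction E D (Finsupp.single p 1)) := by
  refine ⟨fun h p => (h _ _ (single_mem_degreePart μ E p)).2, fun h k c hc =>
    ⟨restriction_mem_degreePart μ E D hc, ?_⟩⟩
  -- Both composites are linear on all of ℤE, so agreement on generators gives every degree at once.
  have : restriction E D ∘ₗ boundary μ n E = boundary μ n D ∘ₗ restriction E D :=
    Finsupp.lhom_ext' fun p => LinearMap.ext_ring (h p)
  exact LinearMap.congr_fun this c

/-- At each `q` in `D` both sides have the same coefficient, since it depends only on `p` and `q`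
and not on the ambient set. -/
theorem restriction_boundary_single_of_mem {E D : Finset X} (hDE : D ⊆ E) (p : E)
    (hp : (p : X) ∈ D) :
    restriction E D (boundary μ n E (Finsupp.single p 1)) =
      boundary μ n D (restriction E D (Finsupp.single p 1)) := by
  ext q
  rw [restriction_apply hDE, boundary_single_apply, restriction_single_of_mem E D p hp,
    boundary_single_apply]

/-- The two chains live in different modules, ℤD and ℤE, but their coefficients over `D` coincide,
and the second has none outside `D`. -/
theorem restriction_boundary_single_eq_zero_iff {E D : Finset X} (hDE : D ⊆ E) (p : E) :
    restriction E D (boundary μ n E (Finsupp.single p 1)) = 0 ↔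
      boundaryComponent μ n E D (Finsupp.single p 1) = 0 := by
  simp only [Finsupp.ext_iff, restriction_apply hDE, boundary_single_apply,
    boundaryComponent_single_apply, Finsupp.zero_apply]
  constructor
  · intro h q
    by_cases hq : (q : X) ∈ D
    · simpa [hq] using h ⟨q, hq⟩
    · simp [hq]
  · intro h q
    simpa using h ⟨q, hDE q.2⟩

theorem isChainMap_restriction_iff_boundaryComponent {E D : Finset X} (hDE : D ⊆ E) :
    IsChainMap μ n (restriction E D) ↔
      ∀ p : E, (p : X) ∉ D → boundaryComponent μ n E D (Finsupp.single p 1) = 0 := by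
  rw [isChainMap_restriction_iff]
  refine forall_congr' fun p => ?_
  by_cases hp : (p : X) ∈ D
  · simp [hp, restriction_boundary_single_of_mem μ n hDE p hp]
  · rw [restriction_single_of_notMem E D p hp, map_zero,
      restriction_boundary_single_eq_zero_iff μ n hDE]
    simp [hp]

end Algebra

end HomoclinicFloer

theorem mainTheorem10 {M : Type*} [TopologicalSpace M] [T2Space M]
    [ChartedSpace HomoclinicFloer.Plane M] [IsManifold (𝓡 2) ∞ M]
    (hM : HomoclinicFloer.IsPlaneOrPositiveGenus M)
    (Ω : HomoclinicFloer.TwoForm M) (hΩ : HomoclinicFloer.IsSymplecticForm Ω)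
    (φ : M ≃ₘ⟮𝓡 2, 𝓡 2⟯ M) (hφ : HomoclinicFloer.IsSymplectomorphism Ω φ)
    (x : M) (hx : HomoclinicFloer.IsHyperbolicFixedPoint φ x)
    (hW : HomoclinicFloer.WOrientationPreserving φ x)
    (hstrong : HomoclinicFloer.StronglyIntersecting φ x)
    (htrans : HomoclinicFloer.TransverselyIntersecting φ x)
    (o : HomoclinicFloer.Plane) (ho : HomoclinicFloer.IsWuOrientation φ x o)
    (E D : Finset (HomoclinicFloer.contractible φ x)) (hDE : D ⊆ E)
    (hE : HomoclinicFloer.IsComplete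
      (HomoclinicFloer.maslov φ x Ω) (HomoclinicFloer.sign φ x Ω o) E)
    (hD : HomoclinicFloer.IsComplete
      (HomoclinicFloer.maslov φ x Ω) (HomoclinicFloer.sign φ x Ω o) D) :
    HomoclinicFloer.IsChainMap
        (HomoclinicFloer.maslov φ x Ω) (HomoclinicFloer.sign φ x Ω o)
        (HomoclinicFloer.restriction E D) ↔
      ∀ p : E, (p : HomoclinicFloer.contractible φ x) ∉ D →
        HomoclinicFloer.boundaryComponent
          (HomoclinicFloer.maslov φ x Ω) (HomoclinicFloer.sign φ x Ω o) E D
          (Finsupp.single p 1) = 0 := by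
  exact HomoclinicFloer.isChainMap_restriction_iff_boundaryComponent _ _ hDE
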